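/- Let $n\ge 2$, let $\Omega\subset\mathbb R^n$ be a bounded open set, and let $1<p<q<n$. For $r\ge 1$ put $$W^{1,r}(\Omega)=\{v\in W^{1,1}(\Omega): D_kv\in L^r(\Omega),\ k=1,\dots,n\},\qquad W^{1,r}_0(\Omega)=\{v\in W^{1,1}_0(\Omega): D_kv\in L^r(\Omega),\ k=1,\dots,n\},$$ where $W_0^{1,1}(\Omega)$ is the closure of $C_c^\infty(\Omega)$ in $W^{1,1}(\Omega)$. Let $a_1,\dots,a_n:\Omega\times\mathbb R^n\to\mathbb R$ be Carathéodory functions, let $0\le h\in L^{q/p}(\Omega)$, and suppose that there are constants $c_1$ and $\tilde\nu>0$ such that, for almost every $x\in\Omega$, all $z,\tilde z\in\mathbb R^n$ and all $i=1,\dots,n$, $$|a_i(x,z)|\le c_1\Big(h(x)+\sum_{j=1}^n|z_j|^p\Big)^{1-1/p},\qquad \tilde\nu\sum_{j=1}^n|z_j-\tilde z_j|^p\le\sum_{j=1}^n\big(a_j(x,z)-a_j(x,\tilde z)\big)(z_j-\tilde z_j).$$ Let $\theta\in W^{1,q}(\Omega)$ and $f^i\in L^{q/(p-1)}(\Omega)$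 for $i=1,\dots,n$. Let $u\in\theta+W^{1,p}_0(\Omega)$ be a solution of the boundary value problem $$\sum_{i=1}^nD_i\big(a_i(x,Du)\big)=\sum_{i=1}^nD_if^i\ \text{ in }\Omega,\qquad u=\theta\ \text{ on }\partial\Omega,$$ that is, $$\int_\Omega\sum_{i=1}^na_i(x,Du)\,D_i\varphi\,dx=\int_\Omega\sum_{i=1}^nf^i\,D_i\varphi\,dx\qquad\text{for every }\varphi\in W_0^{1,p}(\Omega).$$ Then $u-\theta\in L^{t}_{weak}(\Omega)$ with $t=\dfrac{nq}{n-q}$; that is, $u-\theta$ is measurable and there is a constant $K>0$ such that $$|\{x\in\Omega:|u(x)-\theta(x)|>\tau\}|\le\frac{K}{\tau^{t}}\qquad\text{for every }\tau>0.$$ -/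

import Mathlib

open MeasureTheory TopologicalSpace Filter
open scoped Topology Distributions ENNReal

/-- `g` is the weak (distributional) partial derivative `D_k v` on the open set `Ω ⊆ ℝⁿ`:
both functions are locally integrable on `Ω` and
`∫_Ω v ∂_k φ dx = - ∫_Ω g φ dx` for every `φ ∈ C_c^∞(Ω)`. -/
def HasWeakDeriv {n : ℕ} (Ω : Opens (EuclideanSpace ℝ (Fin n))) (k : Fin n)
    (v g : EuclideanSpace ℝ (Fin n) → ℝ) : Prop :=
  LocallyIntegrableOn v (Ω : Set (EuclideanSpace ℝ (Fin n))) volume ∧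
  LocallyIntegrableOn g (Ω : Set (EuclideanSpace ℝ (Fin n))) volume ∧
  ∀ φ : 𝓓(Ω, ℝ),
    ∫ x in (Ω : Set (EuclideanSpace ℝ (Fin n))),
        v x * fderiv ℝ φ x (EuclideanSpace.single k 1) =
      - ∫ x in (Ω : Set (EuclideanSpace ℝ (Fin n))), g x * φ x

/-- Weak partial derivatives are unique up to equality almost everywhere on `Ω`. -/
theorem HasWeakDeriv.ae_eq {n : ℕ} {Ω : Opens (EuclideanSpace ℝ (Fin n))} {k : Fin n}
    {v g₁ g₂ : EuclideanSpace ℝ (Fin n) → ℝ}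
    (h₁ : HasWeakDeriv Ω k v g₁) (h₂ : HasWeakDeriv Ω k v g₂) :
    ∀ᵐ x ∂(volume.restrict (Ω : Set (EuclideanSpace ℝ (Fin n)))), g₁ x = g₂ x := by
  rw [ae_restrict_iff' Ω.isOpen.measurableSet]
  have key := Ω.isOpen.ae_eq_zero_of_integral_contDiff_smul_eq_zero (μ := volume)
    (f := fun x => g₁ x - g₂ x) (h₁.2.1.sub h₂.2.1) (by
      intro φ hφ hc hs
      have e₁ := h₁.2.2 ⟨φ, hφ, hc, hs⟩
      have e₂ := h₂.2.2 ⟨φ, hφ, hc, hs⟩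
      have e : ∫ x in (Ω : Set (EuclideanSpace ℝ (Fin n))), g₁ x * φ x =
          ∫ x in (Ω : Set (EuclideanSpace ℝ (Fin n))), g₂ x * φ x :=
        neg_injective (e₁.symm.trans e₂)
      have hint : ∀ g : EuclideanSpace ℝ (Fin n) → ℝ,
          LocallyIntegrableOn g (Ω : Set (EuclideanSpace ℝ (Fin n))) volume →
          Integrable (fun x => g x * φ x) volume := by
        intro g hg
        have hK : IntegrableOn g (tsupport φ) volume := hg.integrableOn_compact_subset hs hc
        have h2 : IntegrableOn (fun x => g x * φ x) (tsupport φ) volume :=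
          hK.mul_continuousOn hφ.continuous.continuousOn hc
        refine (integrableOn_iff_integrable_of_support_subset ?_).1 h2
        intro x hx
        apply subset_tsupport
        intro h0
        exact hx (by simp [h0])
      have hzero : ∀ g : EuclideanSpace ℝ (Fin n) → ℝ,
          ∫ x in (Ω : Set (EuclideanSpace ℝ (Fin n))), g x * φ x = ∫ x, g x * φ x := by
        intro g
        apply setIntegral_eq_integral_of_forall_compl_eq_zero
        intro x hx
        have : φ x = 0 := image_eq_zero_of_notMem_tsupport (fun h => hx (hs h))
        simp [this]
      rw [hzero, hzero] at e
      have e' : ∀ x, φ x • (g₁ x - g₂ x) = g₁ x * φ x - g₂ x * φ x := by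
        intro x; simp only [smul_eq_mul]; ring
      simp_rw [e']
      rw [integral_sub (hint _ h₁.2.1) (hint _ h₂.2.1), e, sub_self])
  filter_upwards [key] with x hx hxΩ
  exact sub_eq_zero.1 (hx hxΩ)

open Classical in
/-- The weak partial derivative `D_k v` on `Ω` (the zero function if it does not exist).
It is determined up to a null set. -/
noncomputable def weakDeriv {n : ℕ} (Ω : Opens (EuclideanSpace ℝ (Fin n))) (k : Fin n)
    (v : EuclideanSpace ℝ (Fin n) → ℝ) : EuclideanSpace ℝ (Fin n) → ℝ :=
  if h : ∃ g, HasWeakDeriv Ω k v g then h.choose else 0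

/-- The weak gradient `Dv(x) = (D_1 v(x), …, D_n v(x))`. -/
noncomputable def weakGrad {n : ℕ} (Ω : Opens (EuclideanSpace ℝ (Fin n)))
    (v : EuclideanSpace ℝ (Fin n) → ℝ) (x : EuclideanSpace ℝ (Fin n)) :
    EuclideanSpace ℝ (Fin n) :=
  WithLp.toLp 2 (fun k => weakDeriv Ω k v x)

/-- `v ∈ W^{1,1}(Ω)`: `v` is integrable on `Ω` and all its weak partial derivatives exist and
are integrable on `Ω`. -/
def MemW11 {n : ℕ} (Ω : Opens (EuclideanSpace ℝ (Fin n)))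
    (v : EuclideanSpace ℝ (Fin n) → ℝ) : Prop :=
  MemLp v 1 (volume.restrict (Ω : Set (EuclideanSpace ℝ (Fin n)))) ∧
  ∀ k : Fin n, (∃ g, HasWeakDeriv Ω k v g) ∧
    MemLp (weakDeriv Ω k v) 1 (volume.restrict (Ω : Set (EuclideanSpace ℝ (Fin n))))

/-- `v ∈ W_0^{1,1}(Ω)`: `v` belongs to the closure of `C_c^∞(Ω)` in `W^{1,1}(Ω)`. -/
def MemW011 {n : ℕ} (Ω : Opens (EuclideanSpace ℝ (Fin n)))
    (v : EuclideanSpace ℝ (Fin n) → ℝ) : Prop :=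
  MemW11 Ω v ∧ ∃ φ : ℕ → 𝓓(Ω, ℝ),
    Tendsto (fun m => eLpNorm (fun x => φ m x - v x) 1
      (volume.restrict (Ω : Set (EuclideanSpace ℝ (Fin n))))) atTop (𝓝 0) ∧
    ∀ k : Fin n, Tendsto (fun m => eLpNorm
      (fun x => fderiv ℝ (φ m) x (EuclideanSpace.single k 1) - weakDeriv Ω k v x) 1
      (volume.restrict (Ω : Set (EuclideanSpace ℝ (Fin n))))) atTop (𝓝 0)

/-- `v ∈ W^{1,r}(Ω) = {v ∈ W^{1,1}(Ω) : D_k v ∈ L^r(Ω) for every k}`. -/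
def MemW1 {n : ℕ} (Ω : Opens (EuclideanSpace ℝ (Fin n))) (r : ℝ)
    (v : EuclideanSpace ℝ (Fin n) → ℝ) : Prop :=
  MemW11 Ω v ∧ ∀ k : Fin n, MemLp (weakDeriv Ω k v) (ENNReal.ofReal r)
    (volume.restrict (Ω : Set (EuclideanSpace ℝ (Fin n))))

/-- `v ∈ W_0^{1,r}(Ω) = {v ∈ W_0^{1,1}(Ω) : D_k v ∈ L^r(Ω) for every k}`. -/
def MemW01 {n : ℕ} (Ω : Opens (EuclideanSpace ℝ (Fin n))) (r : ℝ)
    (v : EuclideanSpace ℝ (Fin n) → ℝ) : Prop :=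
  MemW011 Ω v ∧ ∀ k : Fin n, MemLp (weakDeriv Ω k v) (ENNReal.ofReal r)
    (volume.restrict (Ω : Set (EuclideanSpace ℝ (Fin n))))

/-- `f ∈ L^t_weak(Ω)`: `f` is (Lebesgue) measurable on `Ω` and, for some `K > 0`,
`|{x ∈ Ω : |f(x)| > τ}| ≤ K / τ^t` for every `τ > 0`. -/
def MemWeakLp {n : ℕ} (Ω : Opens (EuclideanSpace ℝ (Fin n))) (t : ℝ)
    (f : EuclideanSpace ℝ (Fin n) → ℝ) : Prop :=
  AEMeasurable f (volume.restrict (Ω : Set (EuclideanSpace ℝ (Fin n)))) ∧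
  ∃ K : ℝ, 0 < K ∧ ∀ τ : ℝ, 0 < τ →
    volume {x ∈ (Ω : Set (EuclideanSpace ℝ (Fin n))) | τ < |f x|} ≤ ENNReal.ofReal (K / τ ^ t)

/-- `a : Ω × ℝⁿ → ℝ` is a Carathéodory function: `x ↦ a(x, z)` is (Lebesgue) measurable on `Ω`
for every `z`, and `z ↦ a(x, z)` is continuous for almost every `x ∈ Ω`. -/
def IsCaratheodory {n : ℕ} (Ω : Opens (EuclideanSpace ℝ (Fin n)))
    (a : EuclideanSpace ℝ (Fin n) → EuclideanSpace ℝ (Fin n) → ℝ) : Prop :=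
  (∀ z, AEMeasurable (fun x => a x z)
    (volume.restrict (Ω : Set (EuclideanSpace ℝ (Fin n))))) ∧
  ∀ᵐ x ∂(volume.restrict (Ω : Set (EuclideanSpace ℝ (Fin n)))), Continuous (a x)

/-- The growth condition with constant `c` and function `h`: for almost every `x ∈ Ω`, all `z`
and all `i`, `|a_i(x,z)| ≤ c (h(x) + ∑_j |z_j|^p)^{1-1/p}`. -/
def GrowthCondition {n : ℕ} (Ω : Opens (EuclideanSpace ℝ (Fin n))) (p c : ℝ)
    (h : EuclideanSpace ℝ (Fin n) → ℝ)
    (a : Fin n → EuclideanSpace ℝ (Fin n) → EuclideanSpace ℝ (Fin n) → ℝ) : Prop :=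
  ∀ᵐ x ∂(volume.restrict (Ω : Set (EuclideanSpace ℝ (Fin n)))),
    ∀ (z : EuclideanSpace ℝ (Fin n)) (i : Fin n),
      |a i x z| ≤ c * (h x + ∑ j, |z j| ^ p) ^ (1 - 1 / p)

/-- The monotonicity condition with constant `ν`: for almost every `x ∈ Ω` and all `z, z'`,
`ν ∑_i |z_i - z'_i|^p ≤ ∑_i (a_i(x,z) - a_i(x,z')) (z_i - z'_i)`. -/
def MonotonicityCondition {n : ℕ} (Ω : Opens (EuclideanSpace ℝ (Fin n))) (p ν : ℝ)
    (a : Fin n → EuclideanSpace ℝ (Fin n) → EuclideanSpace ℝ (Fin n) → ℝ) : Prop :=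
  ∀ᵐ x ∂(volume.restrict (Ω : Set (EuclideanSpace ℝ (Fin n)))),
    ∀ z z' : EuclideanSpace ℝ (Fin n),
      ν * ∑ i, |z i - z' i| ^ p ≤ ∑ i, (a i x z - a i x z') * (z i - z' i)

/-- `u ∈ θ + W_0^{1,p}(Ω)` is a solution of the boundary value problem
`∑ D_i (a_i(x, Du)) = ∑ D_i f^i` in `Ω`, `u = θ` on `∂Ω`: the integral identity
`∫_Ω ∑ a_i(x, Du) D_i φ dx = ∫_Ω ∑ f^i D_i φ dx` holds for every `φ ∈ W_0^{1,p}(Ω)`. -/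
def IsDirichletSolution {n : ℕ} (Ω : Opens (EuclideanSpace ℝ (Fin n))) (p : ℝ)
    (a : Fin n → EuclideanSpace ℝ (Fin n) → EuclideanSpace ℝ (Fin n) → ℝ)
    (f : Fin n → EuclideanSpace ℝ (Fin n) → ℝ)
    (θ u : EuclideanSpace ℝ (Fin n) → ℝ) : Prop :=
  MemW01 Ω p (fun x => u x - θ x) ∧
  ∀ φ : EuclideanSpace ℝ (Fin n) → ℝ, MemW01 Ω p φ →
    ∫ x in (Ω : Set (EuclideanSpace ℝ (Fin n))),
        ∑ i, a i x (weakGrad Ω u x) * weakDeriv Ω i φ x =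
      ∫ x in (Ω : Set (EuclideanSpace ℝ (Fin n))), ∑ i, f i x * weakDeriv Ω i φ x

/-! Put `w = u - θ`. Let `η` be a truncation vanishing on `[-k, k]`, with derivative `χ` valued in
`[0, 1]`. Testing the equation with `η(w)` and subtracting `∑ a_i(x, Dθ) D_i η(w)` from both sides
leaves the differences `a_i(x, Du) - a_i(x, Dθ)` on the left and `f^i - a_i(x, Dθ)` on the right.
Monotonicity and Young's inequality (`exists_energy_const`) then give `∫ χ(w) ∑ |D_i w|^p ≤ C ∫ χ(w)
G`, where `G = ∑ |f^i - a_i(x, Dθ)|^{p'}` lies in `L^{q/p}` by the growth condition.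

Since `χ(w)` lives on `{|w| > k}`, Hölder's inequality turns the higher integrability of `G` into a
power of `m(k) = |{|w| > k}|`. The Sobolev inequality `W₀^{1,1} → L^{n/(n-1)}` applied to `η(w)`,
with Chebyshev's inequality, yields `k m(3k)^{1-1/n} ≤ C m(k)^{1-1/q}`
(`MemW011.mul_measure_superlevel_rpow_le`). As `1/q - 1/n = 1/t`, the quantity `k^t m(k)` obeys a
sublinear recursion along `k ↦ 3k` and stays bounded (`exists_weak_bound_of_decay`).

The truncation is smooth because `W₀^{1,1}` is a closure of test functions: `η ∘ φ` is again a test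
function, so the chain rule follows by approximation. -/

/-! ### Smooth truncation -/

/-- A smooth monotone truncation that vanishes on `[-k, k]` and grows with slope one away from
that interval. -/
theorem exists_smooth_truncation {k : ℝ} (hk : 0 < k) :
    ∃ η χ : ℝ → ℝ, ContDiff ℝ ((⊤ : ℕ∞) : WithTop ℕ∞) η ∧ (∀ s, HasDerivAt η (χ s) s) ∧
      Continuous χ ∧ (∀ s, 0 ≤ χ s) ∧ (∀ s, χ s ≤ 1) ∧ (∀ s, |s| ≤ k → χ s = 0) ∧ η 0 = 0 ∧
      ∀ s, 3 * k < |s| → k ≤ |η s| := by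
  -- The argument is at most `0` exactly when `|s| ≤ k`, and at least `1` once `|s| ≥ 2k`. Squaring
  -- makes `χ` even, hence its primitive `η` odd.
  set χ : ℝ → ℝ := fun s => Real.smoothTransition ((s / k) ^ 2 - 1) with hχ
  have hsm : ContDiff ℝ ((⊤ : ℕ∞) : WithTop ℕ∞) χ :=
    Real.smoothTransition.contDiff.comp (by fun_prop)
  have hc : Continuous χ := hsm.continuous
  have h0 : ∀ s, 0 ≤ χ s := fun s => Real.smoothTransition.nonneg _
  have hI : ∀ a b, IntervalIntegrable χ volume a b := fun a b => hc.intervalIntegrable a b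
  have hd : ∀ s, HasDerivAt (fun s => ∫ x in (0 : ℝ)..s, χ x) (χ s) s := fun s =>
    intervalIntegral.integral_hasDerivAt_right (hI 0 s)
      (hc.stronglyMeasurableAtFilter _ _) hc.continuousAt
  -- The slope is one beyond `2k`, so a further length `k` lifts the primitive to height `k`; hence
  -- the factor `3`.
  have hpos : ∀ s, 3 * k < s → k ≤ ∫ x in (0 : ℝ)..s, χ x := by
    intro s hs
    have h1 : ∫ x in (2 * k)..s, χ x = s - 2 * k := by
      rw [intervalIntegral.integral_congr (g := fun _ => (1 : ℝ))]
      · simp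
      · intro x hx
        rw [Set.uIcc_of_le (by linarith)] at hx
        apply Real.smoothTransition.one_of_one_le
        have : 2 ≤ x / k := by rw [le_div_iff₀ hk]; exact hx.1
        nlinarith
    have h2 : 0 ≤ ∫ x in (0 : ℝ)..(2 * k), χ x :=
      intervalIntegral.integral_nonneg (by linarith) fun x _ => h0 x
    rw [← intervalIntegral.integral_add_adjacent_intervals (hI 0 (2 * k)) (hI (2 * k) s), h1]
    linarith
  have hodd : ∀ s, ∫ x in (0 : ℝ)..(-s), χ x = -∫ x in (0 : ℝ)..s, χ x := by
    intro s
    have h1 := intervalIntegral.integral_comp_neg (f := χ) (a := 0) (b := s)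
    have h2 : (fun x => χ (-x)) = χ := by
      funext x; simp only [hχ]; congr 2; ring
    rw [neg_zero] at h1
    rw [intervalIntegral.integral_symm, ← h1]
    exact congrArg (fun g : ℝ → ℝ => -∫ x in (0 : ℝ)..s, g x) h2
  refine ⟨fun s => ∫ x in (0 : ℝ)..s, χ x, χ, ?_, hd, hc, h0,
    fun s => Real.smoothTransition.le_one _, ?_, by simp, ?_⟩
  · rw [contDiff_infty_iff_deriv]
    refine ⟨fun s => (hd s).differentiableAt, ?_⟩
    rwa [show deriv (fun s => ∫ x in (0 : ℝ)..s, χ x) = χ from funext fun s => (hd s).deriv]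
  · intro s hs
    apply Real.smoothTransition.zero_of_nonpos
    have : |s / k| ≤ 1 := by rw [abs_div, abs_of_pos hk, div_le_one hk]; exact hs
    have := (sq_le_one_iff_abs_le_one _).2 this
    linarith
  · intro s hs
    rcases le_total 0 s with h | h
    · rw [abs_of_nonneg h] at hs
      exact (hpos s hs).trans (le_abs_self _)
    · rw [abs_of_nonpos h] at hs
      have := hpos _ hs
      rw [hodd] at this
      exact this.trans (neg_le_abs _)

/-! ### Weak derivatives of test functions and of their `L¹` limits -/

theorem HasWeakDeriv.hasWeakDeriv_weakDeriv {n : ℕ} {Ω : Opens (EuclideanSpace ℝ (Fin n))}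
    {k : Fin n} {v g : EuclideanSpace ℝ (Fin n) → ℝ} (h : HasWeakDeriv Ω k v g) :
    HasWeakDeriv Ω k v (weakDeriv Ω k v) := by
  have hex : ∃ g, HasWeakDeriv Ω k v g := ⟨g, h⟩
  rw [weakDeriv, dif_pos hex]
  exact hex.choose_spec

theorem HasWeakDeriv.weakDeriv_ae_eq {n : ℕ} {Ω : Opens (EuclideanSpace ℝ (Fin n))}
    {k : Fin n} {v g : EuclideanSpace ℝ (Fin n) → ℝ} (h : HasWeakDeriv Ω k v g) :
    weakDeriv Ω k v =ᵐ[volume.restrict (Ω : Set (EuclideanSpace ℝ (Fin n)))] g :=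
  h.hasWeakDeriv_weakDeriv.ae_eq h

theorem TestFunction.continuous_partialDeriv {n : ℕ} {Ω : Opens (EuclideanSpace ℝ (Fin n))}
    (φ : 𝓓(Ω, ℝ)) (k : Fin n) :
    Continuous fun x => fderiv ℝ φ x (EuclideanSpace.single k 1) :=
  (φ.contDiff.continuous_fderiv (by simp)).clm_apply continuous_const

theorem TestFunction.hasCompactSupport_partialDeriv {n : ℕ}
    {Ω : Opens (EuclideanSpace ℝ (Fin n))} (φ : 𝓓(Ω, ℝ)) (k : Fin n) :
    HasCompactSupport fun x => fderiv ℝ φ x (EuclideanSpace.single k 1) :=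
  φ.hasCompactSupport.fderiv_apply ℝ _

theorem TestFunction.hasWeakDeriv {n : ℕ} {Ω : Opens (EuclideanSpace ℝ (Fin n))}
    (ψ : 𝓓(Ω, ℝ)) (k : Fin n) :
    HasWeakDeriv Ω k ψ fun x => fderiv ℝ ψ x (EuclideanSpace.single k 1) := by
  refine ⟨ψ.continuous.locallyIntegrable.locallyIntegrableOn _,
    (ψ.continuous_partialDeriv k).locallyIntegrable.locallyIntegrableOn _, fun φ => ?_⟩
  have hout : ∀ x ∉ (Ω : Set (EuclideanSpace ℝ (Fin n))), ψ x = 0 := fun x hx =>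
    image_eq_zero_of_notMem_tsupport fun h => hx (ψ.tsupport_subset h)
  have hout' : ∀ x ∉ (Ω : Set (EuclideanSpace ℝ (Fin n))), φ x = 0 := fun x hx =>
    image_eq_zero_of_notMem_tsupport fun h => hx (φ.tsupport_subset h)
  -- Both integrands vanish off `Ω`, so integration by parts takes place on the whole space, with no
  -- boundary term and no regularity of `∂Ω`.
  rw [setIntegral_eq_integral_of_forall_compl_eq_zero fun x hx => by simp [hout x hx],
    setIntegral_eq_integral_of_forall_compl_eq_zero fun x hx => by simp [hout' x hx]]
  refine integral_mul_fderiv_eq_neg_fderiv_mul_of_integrable ?_ ?_ ?_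
    (fun x _ => ψ.contDiff.differentiable (by simp) x)
    (fun x _ => φ.contDiff.differentiable (by simp) x)
  · exact ((ψ.continuous_partialDeriv k).mul φ.continuous).integrable_of_hasCompactSupport
      φ.hasCompactSupport.mul_left
  · exact (ψ.continuous.mul (φ.continuous_partialDeriv k)).integrable_of_hasCompactSupport
      ψ.hasCompactSupport.mul_right
  · exact (ψ.continuous.mul φ.continuous).integrable_of_hasCompactSupport
      ψ.hasCompactSupport.mul_right

theorem tendsto_integral_mul_of_tendsto_eLpNorm_one {α : Type*} [MeasurableSpace α]
    {μ : Measure α} {F : ℕ → α → ℝ} {f b : α → ℝ} (hF : ∀ m, Integrable (F m) μ)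
    (hf : Integrable f μ) (hb : AEStronglyMeasurable b μ) {C : ℝ} (hC : ∀ x, ‖b x‖ ≤ C)
    (h : Tendsto (fun m => eLpNorm (fun x => F m x - f x) 1 μ) atTop (𝓝 0)) :
    Tendsto (fun m => ∫ x, F m x * b x ∂μ) atTop (𝓝 (∫ x, f x * b x ∂μ)) := by
  refine tendsto_integral_of_L1' _ (hf.1.mul hb)
    (Eventually.of_forall fun m => (hF m).mul_bdd hb (Eventually.of_forall hC)) ?_
  have h2 : Tendsto (fun m => ENNReal.ofReal C * eLpNorm (fun x => F m x - f x) 1 μ)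
      atTop (𝓝 0) := by
    simpa using ENNReal.Tendsto.const_mul h (Or.inr ENNReal.ofReal_ne_top)
  refine tendsto_of_tendsto_of_tendsto_of_le_of_le tendsto_const_nhds h2 (fun _ => zero_le) ?_
  intro m
  refine eLpNorm_le_mul_eLpNorm_of_ae_le_mul (Eventually.of_forall fun x => ?_) 1
  simp only [Pi.sub_apply, Pi.mul_apply]
  rw [← sub_mul, norm_mul, mul_comm]
  exact mul_le_mul_of_nonneg_right (hC x) (norm_nonneg _)

theorem MeasureTheory.MemLp.locallyIntegrableOn_of_restrict {X : Type*} [TopologicalSpace X]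
    [MeasurableSpace X] {μ : Measure X} {s : Set X} {f : X → ℝ} (hf : MemLp f 1 (μ.restrict s)) :
    LocallyIntegrableOn f s μ :=
  IntegrableOn.locallyIntegrableOn (memLp_one_iff_integrable.1 hf)

/-- Weak derivatives pass to limits in `L¹`. -/
theorem hasWeakDeriv_of_tendsto {n : ℕ} {Ω : Opens (EuclideanSpace ℝ (Fin n))} {k : Fin n}
    {v g : EuclideanSpace ℝ (Fin n) → ℝ}
    (hv : MemLp v 1 (volume.restrict (Ω : Set (EuclideanSpace ℝ (Fin n)))))
    (hg : MemLp g 1 (volume.restrict (Ω : Set (EuclideanSpace ℝ (Fin n)))))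
    {ψ : ℕ → 𝓓(Ω, ℝ)}
    (h1 : Tendsto (fun m => eLpNorm (fun x => ψ m x - v x) 1
      (volume.restrict (Ω : Set (EuclideanSpace ℝ (Fin n))))) atTop (𝓝 0))
    (h2 : Tendsto (fun m => eLpNorm
      (fun x => fderiv ℝ (ψ m) x (EuclideanSpace.single k 1) - g x) 1
      (volume.restrict (Ω : Set (EuclideanSpace ℝ (Fin n))))) atTop (𝓝 0)) :
    HasWeakDeriv Ω k v g := by
  refine ⟨hv.locallyIntegrableOn_of_restrict, hg.locallyIntegrableOn_of_restrict, fun φ => ?_⟩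
  obtain ⟨C, hC⟩ := φ.continuous.bounded_above_of_compact_support φ.hasCompactSupport
  obtain ⟨C', hC'⟩ := (φ.continuous_partialDeriv k).bounded_above_of_compact_support
    (φ.hasCompactSupport_partialDeriv k)
  have e1 := tendsto_integral_mul_of_tendsto_eLpNorm_one
    (fun m => ((ψ m).continuous.integrable_of_hasCompactSupport
      (ψ m).hasCompactSupport).integrableOn)
    (memLp_one_iff_integrable.1 hv) (φ.continuous_partialDeriv k).aestronglyMeasurable hC' h1
  have e2 := tendsto_integral_mul_of_tendsto_eLpNorm_one
    (fun m => (((ψ m).continuous_partialDeriv k).integrable_of_hasCompactSupport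
      ((ψ m).hasCompactSupport_partialDeriv k)).integrableOn)
    (memLp_one_iff_integrable.1 hg) φ.continuous.aestronglyMeasurable hC h2
  refine tendsto_nhds_unique (e1.congr fun m => ?_) e2.neg
  exact ((ψ m).hasWeakDeriv k).2.2 φ

/-- The limit `g` of the classical gradients need only be a candidate: the limit passage makes it a
weak gradient, and a.e. uniqueness identifies it with the chosen `weakDeriv`. -/
theorem memW011_of_tendsto {n : ℕ} {Ω : Opens (EuclideanSpace ℝ (Fin n))}
    {v : EuclideanSpace ℝ (Fin n) → ℝ} {g : Fin n → EuclideanSpace ℝ (Fin n) → ℝ}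
    (hv : MemLp v 1 (volume.restrict (Ω : Set (EuclideanSpace ℝ (Fin n)))))
    (hg : ∀ k, MemLp (g k) 1 (volume.restrict (Ω : Set (EuclideanSpace ℝ (Fin n)))))
    {ψ : ℕ → 𝓓(Ω, ℝ)}
    (h1 : Tendsto (fun m => eLpNorm (fun x => ψ m x - v x) 1
      (volume.restrict (Ω : Set (EuclideanSpace ℝ (Fin n))))) atTop (𝓝 0))
    (h2 : ∀ k, Tendsto (fun m => eLpNorm
      (fun x => fderiv ℝ (ψ m) x (EuclideanSpace.single k 1) - g k x) 1
      (volume.restrict (Ω : Set (EuclideanSpace ℝ (Fin n))))) atTop (𝓝 0)) :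
    MemW011 Ω v ∧ ∀ k, weakDeriv Ω k v
      =ᵐ[volume.restrict (Ω : Set (EuclideanSpace ℝ (Fin n)))] g k := by
  have hw := fun k => hasWeakDeriv_of_tendsto hv (hg k) h1 (h2 k)
  have hae := fun k => (hw k).weakDeriv_ae_eq
  refine ⟨⟨⟨hv, fun k => ⟨⟨g k, hw k⟩, (hg k).ae_eq (hae k).symm⟩⟩, ψ, h1, fun k => ?_⟩, hae⟩
  refine (h2 k).congr fun m => eLpNorm_congr_ae ?_
  filter_upwards [hae k] with x hx
  rw [hx]

/-! ### Approximation and chain rule in `W₀^{1,1}` -/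

/-- Functions in `W₀^{1,1}` are approximated by test functions that also converge almost
everywhere. -/
theorem MemW011.exists_seq_tendsto {n : ℕ} {Ω : Opens (EuclideanSpace ℝ (Fin n))}
    {v : EuclideanSpace ℝ (Fin n) → ℝ} (hv : MemW011 Ω v) :
    ∃ φ : ℕ → 𝓓(Ω, ℝ),
    Tendsto (fun m => eLpNorm (fun x => φ m x - v x) 1
      (volume.restrict (Ω : Set (EuclideanSpace ℝ (Fin n))))) atTop (𝓝 0) ∧
    (∀ k : Fin n, Tendsto (fun m => eLpNorm
      (fun x => fderiv ℝ (φ m) x (EuclideanSpace.single k 1) - weakDeriv Ω k v x) 1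
      (volume.restrict (Ω : Set (EuclideanSpace ℝ (Fin n))))) atTop (𝓝 0)) ∧
    ∀ᵐ x ∂(volume.restrict (Ω : Set (EuclideanSpace ℝ (Fin n)))),
      Tendsto (fun m => φ m x) atTop (𝓝 (v x)) := by
  obtain ⟨h11, φ, h1, h2⟩ := hv
  obtain ⟨ns, hns, hae⟩ := (tendstoInMeasure_of_tendsto_eLpNorm one_ne_zero
    (fun m => (φ m).continuous.aestronglyMeasurable) h11.1.1 h1).exists_seq_tendsto_ae
  exact ⟨fun m => φ (ns m), h1.comp hns.tendsto_atTop,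
    fun k => (h2 k).comp hns.tendsto_atTop, hae⟩

theorem abs_sub_le_of_hasDerivAt_of_le_one {η χ : ℝ → ℝ} (hd : ∀ s, HasDerivAt η (χ s) s)
    (h0 : ∀ s, 0 ≤ χ s) (h1 : ∀ s, χ s ≤ 1) (s t : ℝ) : |η s - η t| ≤ |s - t| := by
  have := convex_univ.norm_image_sub_le_of_norm_hasDerivWithin_le (f := η) (f' := χ) (C := 1)
    (x := t) (y := s) (fun x _ => (hd x).hasDerivWithinAt)
    (fun x _ => by rw [Real.norm_of_nonneg (h0 x)]; exact h1 x) trivial trivial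
  simpa using this

/-- The composition of a test function with a smooth function vanishing at zero. -/
noncomputable def TestFunction.compSmooth {n : ℕ} {Ω : Opens (EuclideanSpace ℝ (Fin n))} (φ : 𝓓(Ω, ℝ))
    (η : ℝ → ℝ) (hη : ContDiff ℝ ((⊤ : ℕ∞) : WithTop ℕ∞) η) (h0 : η 0 = 0) : 𝓓(Ω, ℝ) where
  toFun := η ∘ φ
  contDiff' := hη.comp φ.contDiff
  hasCompactSupport' := φ.hasCompactSupport.comp_left h0
  tsupport_subset' :=
    (closure_mono (Function.support_comp_subset h0 φ)).trans φ.tsupport_subset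

/-- Chain rule in `W₀^{1,1}`. -/
theorem MemW011.comp_smooth {n : ℕ} {Ω : Opens (EuclideanSpace ℝ (Fin n))}
    {w : EuclideanSpace ℝ (Fin n) → ℝ} (hw : MemW011 Ω w) {η χ : ℝ → ℝ}
    (hη : ContDiff ℝ ((⊤ : ℕ∞) : WithTop ℕ∞) η) (hd : ∀ s, HasDerivAt η (χ s) s)
    (hc : Continuous χ) (h0 : ∀ s, 0 ≤ χ s) (h1 : ∀ s, χ s ≤ 1) (hz : η 0 = 0) :
    MemW011 Ω (fun x => η (w x)) ∧ ∀ k, weakDeriv Ω k (fun x => η (w x))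
      =ᵐ[volume.restrict (Ω : Set (EuclideanSpace ℝ (Fin n)))]
        fun x => χ (w x) * weakDeriv Ω k w x := by
  obtain ⟨φ, hφ, hφ', hae⟩ := hw.exists_seq_tendsto
  have hwm : AEStronglyMeasurable w (volume.restrict (Ω : Set (EuclideanSpace ℝ (Fin n)))) :=
    hw.1.1.1
  have hDm := fun k => (hw.1.2 k).2.1
  have hlip := abs_sub_le_of_hasDerivAt_of_le_one hd h0 h1
  have hχm := hc.comp_aestronglyMeasurable hwm
  refine memW011_of_tendsto (ψ := fun m => (φ m).compSmooth η hη hz) ?_ ?_ ?_ ?_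
  · refine hw.1.1.mono (hη.continuous.comp_aestronglyMeasurable hwm)
      (Eventually.of_forall fun x => ?_)
    simpa [hz] using hlip (w x) 0
  · intro k
    refine (hw.1.2 k).2.mono (hχm.mul (hDm k)) (Eventually.of_forall fun x => ?_)
    rw [norm_mul, Real.norm_of_nonneg (h0 _)]
    exact mul_le_of_le_one_left (norm_nonneg _) (h1 _)
  · refine tendsto_of_tendsto_of_tendsto_of_le_of_le tendsto_const_nhds hφ
      (fun _ => zero_le) fun m => eLpNorm_mono fun x => hlip _ _
  · intro k
    -- The gradient error is `χ(φ_m)(Dφ_m - Dw) + (χ(φ_m) - χ(w)) Dw`. The first term is controlled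
    -- by `L¹` convergence; this second one needs the a.e. convergence of `φ_m` and dominated
    -- convergence with majorant `|Dw|`.
    have hlim : Tendsto (fun m => eLpNorm
        (fun x => (χ (φ m x) - χ (w x)) * weakDeriv Ω k w x) 1
        (volume.restrict (Ω : Set (EuclideanSpace ℝ (Fin n))))) atTop (𝓝 0) := by
      simp only [eLpNorm_one_eq_lintegral_enorm]
      rw [← lintegral_zero (μ := volume.restrict (Ω : Set (EuclideanSpace ℝ (Fin n))))]
      refine tendsto_lintegral_of_dominated_convergence' (fun x => ‖weakDeriv Ω k w x‖ₑ)
        (fun m => ?_) (fun m => Eventually.of_forall fun x => ?_) ?_ ?_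
      · exact (((hc.comp (φ m).continuous).aestronglyMeasurable.sub hχm).mul (hDm k)).enorm
      · rw [enorm_le_iff_norm_le, norm_mul]
        refine mul_le_of_le_one_left (norm_nonneg _) ?_
        rw [Real.norm_eq_abs, abs_le]
        constructor <;> linarith [h0 (φ m x), h1 (φ m x), h0 (w x), h1 (w x)]
      · exact (memLp_one_iff_integrable.1 (hw.1.2 k).2).2.ne
      · filter_upwards [hae] with x hx
        have e : Tendsto (fun m => (χ (φ m x) - χ (w x)) * weakDeriv Ω k w x) atTop (𝓝 0) := by
          have := (((hc.tendsto (w x)).comp hx).sub_const (χ (w x))).mul_const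
            (weakDeriv Ω k w x)
          simpa using this
        simpa using e.enorm
    have hsum := (hφ' k).add hlim
    rw [add_zero] at hsum
    refine tendsto_of_tendsto_of_tendsto_of_le_of_le tendsto_const_nhds hsum
      (fun _ => zero_le) fun m => ?_
    have hder : ∀ x, fderiv ℝ ((φ m).compSmooth η hη hz) x (EuclideanSpace.single k 1) =
        χ (φ m x) * fderiv ℝ (φ m) x (EuclideanSpace.single k 1) := by
      intro x
      have hf : HasFDerivAt (φ m) (fderiv ℝ (φ m) x) x :=
        ((φ m).contDiff.differentiable (by simp) x).hasFDerivAt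
      have h3 : HasFDerivAt ((φ m).compSmooth η hη hz) (χ (φ m x) • fderiv ℝ (φ m) x) x :=
        (hd (φ m x)).comp_hasFDerivAt x hf
      rw [h3.fderiv]
      rfl
    calc eLpNorm (fun x => fderiv ℝ ((φ m).compSmooth η hη hz) x (EuclideanSpace.single k 1)
            - χ (w x) * weakDeriv Ω k w x) 1 (volume.restrict (Ω : Set _))
        = eLpNorm ((fun x => χ (φ m x) * (fderiv ℝ (φ m) x (EuclideanSpace.single k 1)
            - weakDeriv Ω k w x)) + fun x => (χ (φ m x) - χ (w x)) * weakDeriv Ω k w x) 1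
            (volume.restrict (Ω : Set _)) := by
          congr 1
          funext x
          rw [hder, Pi.add_apply]
          ring
      _ ≤ _ := eLpNorm_add_le
          ((hc.comp (φ m).continuous).aestronglyMeasurable.mul
            (((φ m).continuous_partialDeriv k).aestronglyMeasurable.sub (hDm k)))
          (((hc.comp (φ m).continuous).aestronglyMeasurable.sub hχm).mul (hDm k)) le_rfl
      _ ≤ _ := by
          gcongr
          refine eLpNorm_mono fun x => ?_
          rw [norm_mul, Real.norm_of_nonneg (h0 _)]
          exact mul_le_of_le_one_left (norm_nonneg _) (h1 _)

/-! ### Sobolev inequality with exponent one -/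

theorem enorm_clm_le_sum_enorm_single {n : ℕ} (L : EuclideanSpace ℝ (Fin n) →L[ℝ] ℝ) :
    ‖L‖ₑ ≤ ∑ k, ‖L (EuclideanSpace.single k 1)‖ₑ := by
  have h : ‖L‖ ≤ ∑ k, ‖L (EuclideanSpace.single k 1)‖ := by
    refine L.opNorm_le_bound (Finset.sum_nonneg fun _ _ => norm_nonneg _) fun v => ?_
    have hv : v = ∑ k, v k • EuclideanSpace.single k (1 : ℝ) := by
      ext i; simp [Pi.single_apply]
    conv_lhs => rw [hv, map_sum]
    refine (norm_sum_le _ _).trans ?_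
    rw [Finset.sum_mul]
    refine Finset.sum_le_sum fun k _ => ?_
    rw [map_smul, norm_smul, mul_comm]
    exact mul_le_mul_of_nonneg_left (PiLp.norm_apply_le v k) (norm_nonneg _)
  simp only [← ofReal_norm]
  rw [← ENNReal.ofReal_sum_of_nonneg fun _ _ => norm_nonneg _]
  exact ENNReal.ofReal_le_ofReal h

theorem TestFunction.eLpNorm_le_sum_eLpNorm_partialDeriv {n : ℕ}
    {Ω : Opens (EuclideanSpace ℝ (Fin n))} (ψ : 𝓓(Ω, ℝ)) {r : NNReal}
    (hr : NNReal.HolderConjugate n r) :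
    eLpNorm ψ r (volume.restrict (Ω : Set (EuclideanSpace ℝ (Fin n)))) ≤
      (eLpNormLESNormFDerivOneConst (volume : Measure (EuclideanSpace ℝ (Fin n))) r : ℝ≥0∞) *
        ∑ k, eLpNorm (fun x => fderiv ℝ ψ x (EuclideanSpace.single k 1)) 1
          (volume.restrict (Ω : Set (EuclideanSpace ℝ (Fin n)))) := by
  have hsupp : ∀ k, Function.support (fun x => fderiv ℝ ψ x (EuclideanSpace.single k 1)) ⊆
      (Ω : Set (EuclideanSpace ℝ (Fin n))) := by
    intro k x hx
    refine ψ.tsupport_subset (support_fderiv_subset ℝ fun h => hx ?_)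
    simp only [h]
    rfl
  have hgrad : eLpNorm (fderiv ℝ ψ) 1 volume ≤
      ∑ k, eLpNorm (fun x => fderiv ℝ ψ x (EuclideanSpace.single k 1)) 1
        (volume.restrict (Ω : Set (EuclideanSpace ℝ (Fin n)))) := by
    simp_rw [eLpNorm_restrict_eq_of_support_subset (hsupp _)]
    simp only [eLpNorm_one_eq_lintegral_enorm]
    rw [← lintegral_finsetSum _ fun k _ => (ψ.continuous_partialDeriv k).measurable.enorm]
    exact lintegral_mono fun x => enorm_clm_le_sum_enorm_single _
  have hgns := eLpNorm_le_eLpNorm_fderiv_one (p := r)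
    (volume : Measure (EuclideanSpace ℝ (Fin n))) (ψ.contDiff.of_le (by simp))
    ψ.hasCompactSupport (by rwa [finrank_euclideanSpace_fin])
  exact (eLpNorm_mono_measure ψ Measure.restrict_le_self).trans
    (hgns.trans (mul_le_mul_right hgrad _))

/-- Gagliardo–Nirenberg–Sobolev inequality in `W₀^{1,1}`. -/
theorem MemW011.eLpNorm_le_sum_eLpNorm_weakDeriv {n : ℕ}
    {Ω : Opens (EuclideanSpace ℝ (Fin n))} {v : EuclideanSpace ℝ (Fin n) → ℝ}
    (hv : MemW011 Ω v) {r : NNReal} (hr : NNReal.HolderConjugate n r) :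
    eLpNorm v r (volume.restrict (Ω : Set (EuclideanSpace ℝ (Fin n)))) ≤
      (eLpNormLESNormFDerivOneConst (volume : Measure (EuclideanSpace ℝ (Fin n))) r : ℝ≥0∞) *
        ∑ k, eLpNorm (weakDeriv Ω k v) 1
          (volume.restrict (Ω : Set (EuclideanSpace ℝ (Fin n)))) := by
  obtain ⟨φ, hφ, hφ', hae⟩ := hv.exists_seq_tendsto
  -- Fatou along the a.e. convergent approximants: no convergence in `L^r` is required, only that
  -- the right-hand sides converge.
  refine (Lp.eLpNorm_lim_le_liminf_eLpNorm
    (fun m => (φ m).continuous.aestronglyMeasurable) v hae).trans ?_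
  have hlim : Tendsto (fun m => (eLpNormLESNormFDerivOneConst
      (volume : Measure (EuclideanSpace ℝ (Fin n))) r : ℝ≥0∞) *
      ∑ k, (eLpNorm (fun x => fderiv ℝ (φ m) x (EuclideanSpace.single k 1)
          - weakDeriv Ω k v x) 1 (volume.restrict (Ω : Set (EuclideanSpace ℝ (Fin n))))
        + eLpNorm (weakDeriv Ω k v) 1
          (volume.restrict (Ω : Set (EuclideanSpace ℝ (Fin n)))))) atTop
      (𝓝 ((eLpNormLESNormFDerivOneConst
        (volume : Measure (EuclideanSpace ℝ (Fin n))) r : ℝ≥0∞) *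
      ∑ k, (0 + eLpNorm (weakDeriv Ω k v) 1
          (volume.restrict (Ω : Set (EuclideanSpace ℝ (Fin n))))))) :=
    ENNReal.Tendsto.const_mul (tendsto_finsetSum _ fun k _ => (hφ' k).add_const _)
      (Or.inr ENNReal.coe_ne_top)
  simp only [zero_add] at hlim
  rw [← hlim.liminf_eq]
  refine liminf_le_liminf (Eventually.of_forall fun m => ?_)
  refine ((φ m).eLpNorm_le_sum_eLpNorm_partialDeriv hr).trans ?_
  gcongr with k
  refine le_trans (le_of_eq ?_) (eLpNorm_add_le
    (((φ m).continuous_partialDeriv k).aestronglyMeasurable.sub (hv.1.2 k).2.1)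
    (hv.1.2 k).2.1 le_rfl)
  congr 1
  funext x
  simp

/-! ### Measurability and integrability of the coefficients -/

/-- For a simple function in place of `Z`, the composition is a finite sum of sections `a(·, y)` cut
off to measurable sets. Continuity in the second variable carries measurability to the limit. -/
theorem IsCaratheodory.aemeasurable_comp {n : ℕ} {Ω : Opens (EuclideanSpace ℝ (Fin n))}
    {a : EuclideanSpace ℝ (Fin n) → EuclideanSpace ℝ (Fin n) → ℝ} (ha : IsCaratheodory Ω a)
    {Z : EuclideanSpace ℝ (Fin n) → EuclideanSpace ℝ (Fin n)}
    (hZ : AEMeasurable Z (volume.restrict (Ω : Set (EuclideanSpace ℝ (Fin n))))) :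
    AEMeasurable (fun x => a x (Z x))
      (volume.restrict (Ω : Set (EuclideanSpace ℝ (Fin n)))) := by
  let s := SimpleFunc.approxOn (hZ.mk Z) hZ.measurable_mk Set.univ 0 trivial
  refine aemeasurable_of_tendsto_metrizable_ae atTop (f := fun m x => a x (s m x)) ?_ ?_
  · intro m
    have e : (fun x => a x (s m x)) = ∑ y ∈ (s m).range,
        (s m ⁻¹' {y}).indicator fun x => a x y := by
      funext x
      rw [Finset.sum_apply, Finset.sum_eq_single (s m x)]
      · simp
      · intro y _ hy
        exact Set.indicator_of_notMem (fun h => hy (Eq.symm h)) _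
      · intro h
        exact absurd ((s m).mem_range_self x) h
    rw [e]
    exact Finset.aemeasurable_sum _ fun y _ => (ha.1 y).indicator ((s m).measurableSet_preimage _)
  · filter_upwards [ha.2, hZ.ae_eq_mk] with x hx hZx
    rw [hZx]
    exact (hx.tendsto _).comp (SimpleFunc.tendsto_approxOn _ _ (by simp))

theorem MeasureTheory.MemLp.abs_rpow {α : Type*} [MeasurableSpace α] {μ : Measure α}
    {g : α → ℝ} {r s : ℝ} (hs : 0 < s) (hg : MemLp g (ENNReal.ofReal r) μ) :
    MemLp (fun x => |g x| ^ s) (ENNReal.ofReal (r / s)) μ := by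
  have := hg.norm_rpow_div (ENNReal.ofReal s)
  rwa [ENNReal.toReal_ofReal hs.le, ← ENNReal.ofReal_div_of_pos hs] at this

/-- The exponent is left free because two cases are needed: `r = 1` puts `a(x, Du)` in `L^{p'}`, and
`r = q/p` puts `a(x, Dθ)` in `L^{q/(p-1)}`. -/
theorem memLp_comp_of_growthCondition {n : ℕ} {Ω : Opens (EuclideanSpace ℝ (Fin n))}
    {p c r : ℝ} (hp : 1 < p) {h : EuclideanSpace ℝ (Fin n) → ℝ}
    {a : Fin n → EuclideanSpace ℝ (Fin n) → EuclideanSpace ℝ (Fin n) → ℝ}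
    (ha : ∀ i, IsCaratheodory Ω (a i)) (hgrowth : GrowthCondition Ω p c h a)
    (hh_nonneg : ∀ᵐ x ∂(volume.restrict (Ω : Set (EuclideanSpace ℝ (Fin n)))), 0 ≤ h x)
    (hh : MemLp h (ENNReal.ofReal r) (volume.restrict (Ω : Set (EuclideanSpace ℝ (Fin n)))))
    {Z : EuclideanSpace ℝ (Fin n) → EuclideanSpace ℝ (Fin n)}
    (hZ : ∀ j, MemLp (fun x => Z x j) (ENNReal.ofReal (r * p))
      (volume.restrict (Ω : Set (EuclideanSpace ℝ (Fin n))))) (i : Fin n) :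
    MemLp (fun x => a i x (Z x)) (ENNReal.ofReal (r / (1 - 1 / p)))
      (volume.restrict (Ω : Set (EuclideanSpace ℝ (Fin n)))) := by
  have hp0 : 0 < p := by linarith
  have hexp : 0 < 1 - 1 / p := by
    rw [sub_pos, div_lt_one hp0]; exact hp
  have hH : MemLp (fun x => h x + ∑ j, |Z x j| ^ p) (ENNReal.ofReal r)
      (volume.restrict (Ω : Set (EuclideanSpace ℝ (Fin n)))) := by
    refine hh.add (memLp_finsetSum _ fun j _ => ?_)
    have := (hZ j).abs_rpow hp0
    rwa [mul_div_cancel_right₀ _ hp0.ne'] at this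
  have hZm : AEMeasurable Z (volume.restrict (Ω : Set (EuclideanSpace ℝ (Fin n)))) := by
    have h1 : AEMeasurable (fun x j => Z x j)
        (volume.restrict (Ω : Set (EuclideanSpace ℝ (Fin n)))) :=
      aemeasurable_pi_lambda _ fun j => (hZ j).1.aemeasurable
    exact (PiLp.continuous_toLp 2 (fun _ : Fin n => ℝ)).measurable.comp_aemeasurable h1
  refine ((hH.abs_rpow hexp).const_mul c).mono
    ((ha i).aemeasurable_comp hZm).aestronglyMeasurable ?_
  filter_upwards [hgrowth, hh_nonneg] with x hx hx0
  refine (hx (Z x) i).trans (le_of_le_of_eq ?_ (Real.norm_eq_abs _).symm)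
  have hnn : 0 ≤ h x + ∑ j, |Z x j| ^ p :=
    add_nonneg hx0 (Finset.sum_nonneg fun j _ => Real.rpow_nonneg (abs_nonneg _) _)
  rw [abs_of_nonneg hnn]
  exact le_abs_self _

/-! ### Energy estimate -/

/-- Young's inequality with a prescribed constant in front of the first term. -/
theorem exists_young_const {p p' : ℝ} (hpp : p.HolderConjugate p') {δ : ℝ} (hδ : 0 < δ) :
    ∃ C : ℝ, 0 ≤ C ∧ ∀ s t : ℝ, s * t ≤ δ * |t| ^ p + C * |s| ^ p' := by
  -- Chosen so that `ε^p / p = δ` when Young's inequality is applied to `ε t` and `ε⁻¹ s`.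
  set ε := (δ * p) ^ (1 / p) with hε
  have hδp : 0 < δ * p := mul_pos hδ hpp.pos
  have hε0 : 0 < ε := Real.rpow_pos_of_pos hδp _
  have hεp : ε ^ p = δ * p := by
    rw [hε, ← Real.rpow_mul hδp.le, one_div_mul_cancel hpp.pos.ne', Real.rpow_one]
  refine ⟨(ε⁻¹) ^ p' / p', div_nonneg (Real.rpow_nonneg (inv_nonneg.2 hε0.le) _)
    hpp.symm.pos.le, fun s t => ?_⟩
  have h := Real.young_inequality (ε * t) (ε⁻¹ * s) hpp
  rw [abs_mul, abs_mul, abs_of_pos hε0, abs_of_pos (inv_pos.2 hε0),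
    Real.mul_rpow hε0.le (abs_nonneg _), Real.mul_rpow (inv_pos.2 hε0).le (abs_nonneg _),
    hεp] at h
  calc s * t = ε * t * (ε⁻¹ * s) := by field_simp
    _ ≤ _ := h
    _ = _ := by have := hpp.pos.ne'; field_simp

/-- Energy estimate for a monotone operator tested against a localised gradient. -/
theorem exists_energy_const {p p' ν : ℝ} (hpp : p.HolderConjugate p') (hν : 0 < ν) :
    ∃ C : ℝ, 0 ≤ C ∧ ∀ {α : Type} [MeasurableSpace α] {μ : Measure α} {ι : Type}
      [Fintype ι] {D A F : ι → α → ℝ} {X : α → ℝ},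
      (∀ i, MemLp (D i) (ENNReal.ofReal p) μ) → (∀ i, MemLp (A i) (ENNReal.ofReal p') μ) →
      (∀ i, MemLp (F i) (ENNReal.ofReal p') μ) → AEStronglyMeasurable X μ →
      (∀ x, 0 ≤ X x) → (∀ x, X x ≤ 1) →
      (∀ᵐ x ∂μ, ν * ∑ i, |D i x| ^ p ≤ ∑ i, A i x * D i x) →
      ∫ x, ∑ i, A i x * (X x * D i x) ∂μ = ∫ x, ∑ i, F i x * (X x * D i x) ∂μ →
      ∫ x, X x * ∑ i, |D i x| ^ p ∂μ ≤ C * ∫ x, X x * ∑ i, |F i x| ^ p' ∂μ := by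
  obtain ⟨C, hC0, hC⟩ := exists_young_const hpp (half_pos hν)
  -- Young with weight `ν/2` lets half of the left side absorb the gradient term. The constant
  -- precedes the choice of `X`, hence will not depend on the truncation level.
  refine ⟨2 / ν * C, by positivity, ?_⟩
  intro α _ μ ι _ D A F X hD hA hF hX h0 h1 hmono heq
  have hXb : ∀ x, ‖X x‖ ≤ 1 := fun x => by rw [Real.norm_of_nonneg (h0 x)]; exact h1 x
  have : (ENNReal.ofReal p').HolderTriple (ENNReal.ofReal p) 1 := by
    have := hpp.symm.ennrealOfReal
    exact this
  have hI : ∀ {G : ι → α → ℝ}, (∀ i, MemLp (G i) (ENNReal.ofReal p') μ) →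
      Integrable (fun x => ∑ i, G i x * (X x * D i x)) μ := by
    intro G hG
    refine integrable_finsetSum _ fun i _ => ?_
    have := ((hG i).integrable_mul (hD i)).bdd_mul hX (Eventually.of_forall hXb)
    refine this.congr (Eventually.of_forall fun x => ?_)
    simp only [Pi.mul_apply]
    ring
  have hP : ∀ {G : ι → α → ℝ} {s : ℝ}, 0 < s → (∀ i, MemLp (G i) (ENNReal.ofReal s) μ) →
      Integrable (fun x => X x * ∑ i, |G i x| ^ s) μ := by
    intro G s hs hG
    refine Integrable.bdd_mul (integrable_finsetSum _ fun i _ => ?_) hX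
      (Eventually.of_forall hXb)
    have := (hG i).abs_rpow hs
    rw [div_self hs.ne', ENNReal.ofReal_one] at this
    exact memLp_one_iff_integrable.1 this
  have hDp := hP hpp.pos hD
  have hFp := hP hpp.symm.pos hF
  have e1 : ν * ∫ x, X x * ∑ i, |D i x| ^ p ∂μ ≤ ∫ x, ∑ i, A i x * (X x * D i x) ∂μ := by
    rw [← integral_const_mul]
    refine integral_mono_ae (hDp.const_mul ν) (hI hA) ?_
    filter_upwards [hmono] with x hx
    calc ν * (X x * ∑ i, |D i x| ^ p) = X x * (ν * ∑ i, |D i x| ^ p) := by ring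
      _ ≤ X x * ∑ i, A i x * D i x := mul_le_mul_of_nonneg_left hx (h0 x)
      _ = _ := by
        rw [Finset.mul_sum]
        exact Finset.sum_congr rfl fun i _ => by ring
  have e2 : ∫ x, ∑ i, F i x * (X x * D i x) ∂μ ≤
      ν / 2 * (∫ x, X x * ∑ i, |D i x| ^ p ∂μ) + C * ∫ x, X x * ∑ i, |F i x| ^ p' ∂μ := by
    rw [← integral_const_mul, ← integral_const_mul,
      ← integral_add (hDp.const_mul _) (hFp.const_mul _)]
    refine integral_mono (hI hF) ((hDp.const_mul _).add (hFp.const_mul _)) fun x => ?_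
    calc ∑ i, F i x * (X x * D i x) = X x * ∑ i, F i x * D i x := by
          rw [Finset.mul_sum]
          exact Finset.sum_congr rfl fun i _ => by ring
      _ ≤ X x * ∑ i, (ν / 2 * |D i x| ^ p + C * |F i x| ^ p') :=
          mul_le_mul_of_nonneg_left (Finset.sum_le_sum fun i _ => hC _ _) (h0 x)
      _ = _ := by
          rw [Finset.sum_add_distrib, ← Finset.mul_sum, ← Finset.mul_sum]
          ring
  rw [heq] at e1
  have e3 := e1.trans e2
  rw [mul_assoc, div_mul_eq_mul_div, le_div_iff₀ hν]
  linarith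

/-! ### Decay of superlevel sets -/

/-- Hölder's inequality on `A`; passing to a measurable hull of equal measure removes any
measurability assumption on `A`. -/
theorem eLpNorm_one_le_of_support_subset {α : Type*} [MeasurableSpace α] {μ : Measure α}
    {g : α → ℝ} {r : ℝ} (hr : 1 ≤ r) (hg : AEStronglyMeasurable g μ) {A : Set α}
    (hA : Function.support g ⊆ A) :
    eLpNorm g 1 μ ≤ eLpNorm g (ENNReal.ofReal r) μ * μ A ^ (1 - 1 / r) := by
  have hA' := hA.trans (subset_toMeasurable μ A)
  have h := eLpNorm_le_eLpNorm_mul_rpow_measure_univ (p := 1) (q := ENNReal.ofReal r)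
    (by simpa using hr) (hg.restrict (s := toMeasurable μ A))
  rwa [eLpNorm_restrict_eq_of_support_subset hA', eLpNorm_restrict_eq_of_support_subset hA',
    Measure.restrict_apply_univ, measure_toMeasurable, ENNReal.toReal_one, div_one,
    ENNReal.toReal_ofReal (by linarith)] at h

/-- A Stampacchia-type iteration. -/
theorem exists_weak_bound_of_decay {m : ℝ → ℝ} {m₀ C α β t : ℝ} (hm : ∀ k, 0 ≤ m k)
    (hm₀ : ∀ k, m k ≤ m₀) (hC : 0 ≤ C) (hβ : 0 ≤ β) (hα : 0 < α) (ht : 0 < t)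
    (htab : t * (α - β) = 1)
    (hdec : ∀ k, 0 < k → k * m (3 * k) ^ α ≤ C * m k ^ β) :
    ∃ K, 0 < K ∧ ∀ k, 0 < k → m k ≤ K / k ^ t := by
  set C' := (3 ^ t) ^ α * C with hC'
  have hC'0 : 0 ≤ C' := by positivity
  -- `m₀` covers `k ≤ 1`, the `1` makes `K` positive, and `C' ^ t` gives `C' ≤ K^{α-β}` because
  -- `t(α-β) = 1`. Then `y ≤ K` implies `C' y^β ≤ K^α`.
  set K := max (max m₀ 1) (C' ^ t) with hK
  have hK1 : 1 ≤ K := (le_max_right _ _).trans (le_max_left _ _)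
  have hK0 : 0 < K := by linarith
  have hKC : C' * K ^ β ≤ K ^ α := by
    have h1 : C' ≤ K ^ (α - β) := by
      calc C' = (C' ^ t) ^ (α - β) := by rw [← Real.rpow_mul hC'0, htab, Real.rpow_one]
        _ ≤ K ^ (α - β) := by
          refine Real.rpow_le_rpow (by positivity) (le_max_right _ _) ?_
          exact (pos_of_mul_pos_right (htab ▸ one_pos) ht.le).le
    calc C' * K ^ β ≤ K ^ (α - β) * K ^ β := by gcongr
      _ = K ^ α := by rw [← Real.rpow_add hK0]; ring_nf
  have hstep : ∀ k, 0 < k →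
      ((3 * k) ^ t * m (3 * k)) ^ α ≤ C' * (k ^ t * m k) ^ β := by
    intro k hk
    -- The relation `tα = tβ + 1` is what absorbs the factor `k` of the decay hypothesis exactly.
    have hkt : (k ^ t) ^ α = (k ^ t) ^ β * k := by
      rw [← Real.rpow_mul hk.le, ← Real.rpow_mul hk.le]
      nth_rewrite 3 [← Real.rpow_one k]
      rw [← Real.rpow_add hk]
      congr 1
      linarith
    have h3 := hm (3 * k)
    have h4 := hm k
    rw [Real.mul_rpow (by positivity) h3, Real.mul_rpow (by norm_num) hk.le,
      Real.mul_rpow (by positivity) (by positivity), Real.mul_rpow (by positivity) h4, hkt]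
    calc (3 ^ t) ^ α * ((k ^ t) ^ β * k) * m (3 * k) ^ α
        = (3 ^ t) ^ α * (k ^ t) ^ β * (k * m (3 * k) ^ α) := by ring
      _ ≤ (3 ^ t) ^ α * (k ^ t) ^ β * (C * m k ^ β) :=
          mul_le_mul_of_nonneg_left (hdec k hk) (by positivity)
      _ = _ := by rw [hC']; ring
  -- Induction on scales: `k ≤ 3^{j+1}` is reduced to `k/3`, and the bound `K` reproduces itself.
  have hind : ∀ j : ℕ, ∀ k, 0 < k → k ≤ 3 ^ j → k ^ t * m k ≤ K := by
    intro j
    induction j with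
    | zero =>
      intro k hk hk1
      rw [pow_zero] at hk1
      calc k ^ t * m k ≤ 1 * m k :=
            mul_le_mul_of_nonneg_right (Real.rpow_le_one hk.le hk1 ht.le) (hm k)
        _ ≤ K := by
            rw [one_mul]
            exact (hm₀ k).trans ((le_max_left _ _).trans (le_max_left _ _))
    | succ j ih =>
      intro k hk hkj
      have hk3 : 0 < k / 3 := by positivity
      have h1 := ih (k / 3) hk3 (by rw [pow_succ] at hkj; linarith)
      have h2 := hstep (k / 3) hk3
      rw [mul_div_cancel₀ k (by norm_num : (3 : ℝ) ≠ 0)] at h2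
      have h5 := hm k
      have h6 := hm (k / 3)
      have h3 : (k ^ t * m k) ^ α ≤ K ^ α :=
        h2.trans (le_trans (by gcongr) hKC)
      exact (Real.rpow_le_rpow_iff (by positivity) hK0.le hα).1 h3
  refine ⟨K, hK0, fun k hk => ?_⟩
  obtain ⟨j, hj⟩ := pow_unbounded_of_one_lt k (by norm_num : (1 : ℝ) < 3)
  rw [le_div_iff₀ (by positivity), mul_comm]
  exact hind j k hk hj.le

theorem ofReal_integral_le_eLpNorm_one {α : Type*} [MeasurableSpace α] {μ : Measure α}
    (g : α → ℝ) : ENNReal.ofReal (∫ x, g x ∂μ) ≤ eLpNorm g 1 μ := by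
  rw [eLpNorm_one_eq_lintegral_enorm]
  exact (Real.ofReal_le_enorm _).trans (enorm_integral_le_lintegral_enorm _)

/-- Since `0 ≤ X ≤ 1` and `p > 1`, one has `X^p ≤ X`; thus the energy weighted by `X` controls the
`L^p` norm of the truncated gradient. -/
theorem eLpNorm_mul_le_ofReal_integral_rpow {α : Type*} [MeasurableSpace α] {μ : Measure α}
    {ι : Type*} [Fintype ι] {p : ℝ} (hp : 1 < p) {X : α → ℝ} {D : ι → α → ℝ}
    (hX : AEStronglyMeasurable X μ) (h0 : ∀ x, 0 ≤ X x) (h1 : ∀ x, X x ≤ 1)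
    (hD : ∀ i, MemLp (D i) (ENNReal.ofReal p) μ) (i : ι) :
    eLpNorm (fun x => X x * D i x) (ENNReal.ofReal p) μ ≤
      ENNReal.ofReal (∫ x, X x * ∑ j, |D j x| ^ p ∂μ) ^ (1 / p) := by
  have hp0 : 0 < p := by linarith
  have hint : Integrable (fun x => X x * ∑ j, |D j x| ^ p) μ := by
    refine Integrable.bdd_mul (c := 1) (integrable_finsetSum _ fun j _ => ?_) hX
      (Eventually.of_forall fun x => by rw [Real.norm_of_nonneg (h0 x)]; exact h1 x)
    have := (hD j).abs_rpow hp0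
    rw [div_self hp0.ne', ENNReal.ofReal_one] at this
    exact memLp_one_iff_integrable.1 this
  have hnn : ∀ x j, 0 ≤ |D j x| ^ p := fun x j => Real.rpow_nonneg (abs_nonneg _) _
  rw [eLpNorm_eq_lintegral_rpow_enorm_toReal (by simpa using hp0) ENNReal.ofReal_ne_top,
    ENNReal.toReal_ofReal hp0.le, ofReal_integral_eq_lintegral_ofReal hint
      (Eventually.of_forall fun x => mul_nonneg (h0 x) (Finset.sum_nonneg fun j _ => hnn x j))]
  refine ENNReal.rpow_le_rpow (lintegral_mono fun x => ?_) (by positivity)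
  rw [← ofReal_norm, ENNReal.ofReal_rpow_of_nonneg (norm_nonneg _) hp0.le]
  refine ENNReal.ofReal_le_ofReal ?_
  rw [norm_mul, Real.norm_of_nonneg (h0 x), Real.mul_rpow (h0 x) (norm_nonneg _)]
  refine mul_le_mul ?_ (Finset.single_le_sum (f := fun j => |D j x| ^ p)
    (fun j _ => hnn x j) (Finset.mem_univ i)) (hnn x i) (h0 x)
  calc X x ^ p ≤ X x ^ (1 : ℝ) := Real.rpow_le_rpow_of_exponent_ge' (h0 x) (h1 x) one_pos.le hp.le
    _ = X x := Real.rpow_one _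

/-- Decay of the measure of superlevel sets from a localised energy estimate. -/
theorem MemW011.mul_measure_superlevel_rpow_le {n : ℕ}
    {Ω : Opens (EuclideanSpace ℝ (Fin n))} {w : EuclideanSpace ℝ (Fin n) → ℝ}
    (hw : MemW011 Ω w) {p s : ℝ} (hp : 1 < p) (hs : 1 ≤ s)
    (hD : ∀ i, MemLp (weakDeriv Ω i w) (ENNReal.ofReal p)
      (volume.restrict (Ω : Set (EuclideanSpace ℝ (Fin n)))))
    {r : NNReal} (hr : NNReal.HolderConjugate n r) {k : ℝ} {η χ : ℝ → ℝ}
    (hη : ContDiff ℝ ((⊤ : ℕ∞) : WithTop ℕ∞) η) (hd : ∀ s, HasDerivAt η (χ s) s)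
    (hc : Continuous χ) (h0 : ∀ s, 0 ≤ χ s) (h1 : ∀ s, χ s ≤ 1) (hz : η 0 = 0)
    (hχk : ∀ s, |s| ≤ k → χ s = 0) (hηk : ∀ s, 3 * k < |s| → k ≤ |η s|)
    {G : EuclideanSpace ℝ (Fin n) → ℝ} (hG : MemLp G (ENNReal.ofReal s)
      (volume.restrict (Ω : Set (EuclideanSpace ℝ (Fin n))))) {C : ℝ} (hC : 0 ≤ C)
    (hE : ∫ x in (Ω : Set (EuclideanSpace ℝ (Fin n))),
        χ (w x) * ∑ i, |weakDeriv Ω i w x| ^ p ≤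
      C * ∫ x in (Ω : Set (EuclideanSpace ℝ (Fin n))), χ (w x) * G x) :
    ENNReal.ofReal k * (volume.restrict (Ω : Set (EuclideanSpace ℝ (Fin n))))
        {x | 3 * k < |w x|} ^ (1 / (r : ℝ)) ≤
      (eLpNormLESNormFDerivOneConst (volume : Measure (EuclideanSpace ℝ (Fin n))) r : ℝ≥0∞) *
        n * (ENNReal.ofReal C * eLpNorm G (ENNReal.ofReal s)
          (volume.restrict (Ω : Set (EuclideanSpace ℝ (Fin n))))) ^ (1 / p) *
        (volume.restrict (Ω : Set (EuclideanSpace ℝ (Fin n)))) {x | k < |w x|} ^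
          ((1 - 1 / s) * (1 / p) + (1 - 1 / p)) := by
  set μ := volume.restrict (Ω : Set (EuclideanSpace ℝ (Fin n))) with hμ
  have hp0 : 0 < p := by linarith
  have hs0 : 0 < s := by linarith
  have hp1 : 0 ≤ 1 - 1 / p := by
    rw [sub_nonneg, div_le_one hp0]; exact hp.le
  have hs1 : 0 ≤ 1 - 1 / s := by
    rw [sub_nonneg, div_le_one hs0]; exact hs
  have hr0 : 0 < (r : ℝ) := by exact_mod_cast hr.symm.pos
  obtain ⟨hv, hDv⟩ := hw.comp_smooth hη hd hc h0 h1 hz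
  have hX : AEStronglyMeasurable (fun x => χ (w x)) μ :=
    hc.comp_aestronglyMeasurable hw.1.1.1
  have hsupp : ∀ g : EuclideanSpace ℝ (Fin n) → ℝ,
      Function.support (fun x => χ (w x) * g x) ⊆ {x | k < |w x|} := by
    intro g x hx
    by_contra hcon
    exact hx (by simp [hχk (w x) (not_lt.1 hcon)])
  have hEG : ENNReal.ofReal (∫ x, χ (w x) * ∑ i, |weakDeriv Ω i w x| ^ p ∂μ) ≤
      ENNReal.ofReal C * eLpNorm G (ENNReal.ofReal s) μ * μ {x | k < |w x|} ^ (1 - 1 / s) := by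
    refine (ENNReal.ofReal_le_ofReal hE).trans ?_
    rw [ENNReal.ofReal_mul hC, mul_assoc]
    gcongr
    refine (ofReal_integral_le_eLpNorm_one _).trans
      ((eLpNorm_one_le_of_support_subset hs (hX.mul hG.1) (hsupp G)).trans ?_)
    gcongr
    refine eLpNorm_mono fun x => ?_
    rw [Pi.mul_apply, norm_mul, Real.norm_of_nonneg (h0 _)]
    exact mul_le_of_le_one_left (norm_nonneg _) (h1 _)
  have hDi : ∀ i, eLpNorm (weakDeriv Ω i fun x => η (w x)) 1 μ ≤
      (ENNReal.ofReal C * eLpNorm G (ENNReal.ofReal s) μ) ^ (1 / p) *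
        μ {x | k < |w x|} ^ ((1 - 1 / s) * (1 / p) + (1 - 1 / p)) := by
    intro i
    rw [eLpNorm_congr_ae (hDv i)]
    refine (eLpNorm_one_le_of_support_subset hp.le (hX.mul (hD i).1) (hsupp _)).trans ?_
    -- The two parts of the exponent have separate sources: `1 - 1/p` from Hölder between `L^p` and
    -- `L¹`, and `(1 - 1/s)/p` from the energy bound.
    rw [ENNReal.rpow_add_of_nonneg _ _ (by positivity) hp1, ← mul_assoc]
    gcongr
    refine (eLpNorm_mul_le_ofReal_integral_rpow hp hX (fun _ => h0 _) (fun _ => h1 _)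
      hD i).trans ?_
    rw [ENNReal.rpow_mul, ← ENNReal.mul_rpow_of_nonneg _ _ (by positivity)]
    exact ENNReal.rpow_le_rpow hEG (by positivity)
  -- Chebyshev for `η(w)`, whose modulus is at least `k` where `|w| > 3k`.
  have hcheb : ENNReal.ofReal k * μ {x | 3 * k < |w x|} ^ (1 / (r : ℝ)) ≤
      eLpNorm (fun x => η (w x)) r μ := by
    have h := mul_meas_ge_le_pow_eLpNorm' μ (p := r) (by simpa using hr.symm.pos.ne')
      ENNReal.coe_ne_top (hη.continuous.comp_aestronglyMeasurable hw.1.1.1) (ENNReal.ofReal k)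
    rw [ENNReal.coe_toReal] at h
    rw [← ENNReal.rpow_le_rpow_iff hr0, ENNReal.mul_rpow_of_nonneg _ _ hr0.le,
      ← ENNReal.rpow_mul, one_div_mul_cancel hr0.ne', ENNReal.rpow_one]
    refine le_trans ?_ h
    gcongr with x
    intro hx
    rw [← ofReal_norm]
    exact ENNReal.ofReal_le_ofReal (hηk _ hx)
  refine hcheb.trans ((hv.eLpNorm_le_sum_eLpNorm_weakDeriv hr).trans ?_)
  rw [mul_assoc, mul_assoc]
  gcongr
  refine (Finset.sum_le_sum fun i _ => hDi i).trans ?_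
  simp

/-! ### Additivity of weak derivatives -/

theorem MeasureTheory.LocallyIntegrableOn.integrable_mul_of_support_subset {n : ℕ}
    {Ω : Opens (EuclideanSpace ℝ (Fin n))} {v b : EuclideanSpace ℝ (Fin n) → ℝ}
    (hv : LocallyIntegrableOn v (Ω : Set (EuclideanSpace ℝ (Fin n))) volume) (φ : 𝓓(Ω, ℝ))
    (hb : Continuous b) (hs : Function.support b ⊆ tsupport φ) :
    Integrable (fun x => v x * b x)
      (volume.restrict (Ω : Set (EuclideanSpace ℝ (Fin n)))) := by
  have h1 : IntegrableOn v (tsupport φ) volume :=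
    hv.integrableOn_compact_subset φ.tsupport_subset φ.hasCompactSupport
  have h2 : IntegrableOn (fun x => v x * b x) (tsupport φ) volume :=
    h1.mul_continuousOn hb.continuousOn φ.hasCompactSupport
  refine ((integrableOn_iff_integrable_of_support_subset fun x hx => hs fun h0 => ?_).1
    h2).integrableOn
  exact hx (by simp [h0])

theorem HasWeakDeriv.add {n : ℕ} {Ω : Opens (EuclideanSpace ℝ (Fin n))} {k : Fin n}
    {v v' g g' : EuclideanSpace ℝ (Fin n) → ℝ} (h : HasWeakDeriv Ω k v g)
    (h' : HasWeakDeriv Ω k v' g') :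
    HasWeakDeriv Ω k (fun x => v x + v' x) (fun x => g x + g' x) := by
  refine ⟨h.1.add h'.1, h.2.1.add h'.2.1, fun φ => ?_⟩
  have hs : Function.support (fun x => fderiv ℝ φ x (EuclideanSpace.single k 1)) ⊆
      tsupport φ := fun x hx => support_fderiv_subset ℝ fun h => hx (by simp only [h]; rfl)
  have hc := φ.continuous_partialDeriv k
  simp only [add_mul]
  rw [integral_add (h.1.integrable_mul_of_support_subset φ hc hs)
      (h'.1.integrable_mul_of_support_subset φ hc hs),
    integral_add (h.2.1.integrable_mul_of_support_subset φ φ.continuous (subset_tsupport _))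
      (h'.2.1.integrable_mul_of_support_subset φ φ.continuous (subset_tsupport _)),
    h.2.2 φ, h'.2.2 φ, neg_add]

theorem MemW11.weakDeriv_add_ae_eq {n : ℕ} {Ω : Opens (EuclideanSpace ℝ (Fin n))}
    {v v' : EuclideanSpace ℝ (Fin n) → ℝ} (hv : MemW11 Ω v) (hv' : MemW11 Ω v') (k : Fin n) :
    weakDeriv Ω k (fun x => v x + v' x)
      =ᵐ[volume.restrict (Ω : Set (EuclideanSpace ℝ (Fin n)))]
        fun x => weakDeriv Ω k v x + weakDeriv Ω k v' x := by
  obtain ⟨g, hg⟩ := (hv.2 k).1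
  obtain ⟨g', hg'⟩ := (hv'.2 k).1
  exact (hg.hasWeakDeriv_weakDeriv.add hg'.hasWeakDeriv_weakDeriv).weakDeriv_ae_eq

/-! ### Weak-type bound and conclusion -/

theorem memWeakLp_of_decay {n : ℕ} {Ω : Opens (EuclideanSpace ℝ (Fin n))}
    [IsFiniteMeasure (volume.restrict (Ω : Set (EuclideanSpace ℝ (Fin n))))]
    {w : EuclideanSpace ℝ (Fin n) → ℝ}
    (hw : AEMeasurable w (volume.restrict (Ω : Set (EuclideanSpace ℝ (Fin n)))))
    {α β t : ℝ} (hβ : 0 ≤ β) (hα : 0 < α) (ht : 0 < t) (htab : t * (α - β) = 1)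
    {C : ℝ≥0∞} (hC : C ≠ ∞)
    (hdec : ∀ k : ℝ, 0 < k → ENNReal.ofReal k *
        (volume.restrict (Ω : Set (EuclideanSpace ℝ (Fin n)))) {x | 3 * k < |w x|} ^ α ≤
      C * (volume.restrict (Ω : Set (EuclideanSpace ℝ (Fin n)))) {x | k < |w x|} ^ β) :
    MemWeakLp Ω t w := by
  set μ := volume.restrict (Ω : Set (EuclideanSpace ℝ (Fin n))) with hμ
  obtain ⟨K, hK0, hK⟩ := exists_weak_bound_of_decay (m := fun k => μ.real {x | k < |w x|})
    (m₀ := μ.real Set.univ) (C := C.toReal) (fun k => measureReal_nonneg)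
    (fun k => measureReal_mono (Set.subset_univ _)) ENNReal.toReal_nonneg hβ hα ht htab (by
      intro k hk
      have h := ENNReal.toReal_mono
        (ENNReal.mul_ne_top hC (ENNReal.rpow_ne_top_of_nonneg hβ (measure_ne_top _ _)))
        (hdec k hk)
      rwa [ENNReal.toReal_mul, ENNReal.toReal_mul, ENNReal.toReal_ofReal hk.le,
        ← ENNReal.toReal_rpow, ← ENNReal.toReal_rpow] at h)
  refine ⟨hw, K, hK0, fun τ hτ => ?_⟩
  have e : volume {x ∈ (Ω : Set (EuclideanSpace ℝ (Fin n))) | τ < |w x|} =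
      μ {x | τ < |w x|} := by
    rw [hμ, Measure.restrict_apply' Ω.isOpen.measurableSet, Set.inter_comm]
    rfl
  rw [e, ← ofReal_measureReal]
  exact ENNReal.ofReal_le_ofReal (hK τ hτ)

theorem mainTheorem4 {n : ℕ} (hn : 2 ≤ n)
    (Ω : Opens (EuclideanSpace ℝ (Fin n)))
    (hΩ : Bornology.IsBounded (Ω : Set (EuclideanSpace ℝ (Fin n))))
    (p q : ℝ) (hp : 1 < p) (hpq : p < q) (hqn : q < n)
    (a : Fin n → EuclideanSpace ℝ (Fin n) → EuclideanSpace ℝ (Fin n) → ℝ)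
    (ha : ∀ i, IsCaratheodory Ω (a i))
    (h : EuclideanSpace ℝ (Fin n) → ℝ)
    (hh_nonneg : ∀ᵐ x ∂(volume.restrict (Ω : Set (EuclideanSpace ℝ (Fin n)))), 0 ≤ h x)
    (hh : MemLp h (ENNReal.ofReal (q / p))
      (volume.restrict (Ω : Set (EuclideanSpace ℝ (Fin n)))))
    (c₁ : ℝ) (hgrowth : GrowthCondition Ω p c₁ h a)
    (ν : ℝ) (hν : 0 < ν) (hmono : MonotonicityCondition Ω p ν a)
    (f : Fin n → EuclideanSpace ℝ (Fin n) → ℝ)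
    (hf : ∀ i, MemLp (f i) (ENNReal.ofReal (q / (p - 1)))
      (volume.restrict (Ω : Set (EuclideanSpace ℝ (Fin n)))))
    (θ : EuclideanSpace ℝ (Fin n) → ℝ) (hθ : MemW1 Ω q θ)
    (u : EuclideanSpace ℝ (Fin n) → ℝ) (hu : IsDirichletSolution Ω p a f θ u) :
    MemWeakLp Ω (n * q / (n - q)) (fun x => u x - θ x) := by
  have hp0 : 0 < p := by linarith
  have hq0 : 0 < q := by linarith
  have hn0 : (0 : ℝ) < n := by linarith
  have hp1 : p - 1 ≠ 0 := by linarith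
  have hfin : IsFiniteMeasure (volume.restrict (Ω : Set (EuclideanSpace ℝ (Fin n)))) :=
    ⟨by rw [Measure.restrict_apply_univ]; exact hΩ.measure_lt_top⟩
  set μ := volume.restrict (Ω : Set (EuclideanSpace ℝ (Fin n))) with hμ
  set p' := p / (p - 1) with hp'
  have hpp : p.HolderConjugate p' := Real.HolderConjugate.conjExponent hp
  have hp'0 : 0 < p' := hpp.symm.pos
  have hs : 1 ≤ q / p := by rw [le_div_iff₀ hp0]; linarith
  obtain ⟨⟨hw, hDw⟩, heq⟩ := hu
  set w : EuclideanSpace ℝ (Fin n) → ℝ := fun x => u x - θ x with hwdef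
  have hDθq : ∀ j, MemLp (weakDeriv Ω j θ) (ENNReal.ofReal q) μ := hθ.2
  have hDθp : ∀ j, MemLp (weakDeriv Ω j θ) (ENNReal.ofReal p) μ := fun j =>
    (hDθq j).mono_exponent (ENNReal.ofReal_le_ofReal hpq.le)
  have hDu : ∀ j, weakDeriv Ω j u =ᵐ[μ] fun x => weakDeriv Ω j w x + weakDeriv Ω j θ x := by
    intro j
    have h1 := hw.1.weakDeriv_add_ae_eq hθ.1 j
    rwa [show (fun x => w x + θ x) = u from funext fun x => sub_add_cancel _ _] at h1
  have hDup : ∀ j, MemLp (weakDeriv Ω j u) (ENNReal.ofReal p) μ := fun j =>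
    ((hDw j).add (hDθp j)).ae_eq (hDu j).symm
  have hau : ∀ i, MemLp (fun x => a i x (weakGrad Ω u x)) (ENNReal.ofReal p') μ := by
    intro i
    have h1 := memLp_comp_of_growthCondition (r := 1) (Z := weakGrad Ω u) hp ha hgrowth
      hh_nonneg (hh.mono_exponent (ENNReal.ofReal_le_ofReal hs))
      (fun j => by rw [one_mul]; exact hDup j) i
    rwa [show 1 / (1 - 1 / p) = p' by rw [hp']; field_simp] at h1
  have haθ : ∀ i, MemLp (fun x => a i x (weakGrad Ω θ x)) (ENNReal.ofReal (q / (p - 1))) μ := by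
    intro i
    have h1 := memLp_comp_of_growthCondition (r := q / p) (Z := weakGrad Ω θ) hp ha hgrowth
      hh_nonneg hh (fun j => by rw [div_mul_cancel₀ _ hp0.ne']; exact hDθq j) i
    rwa [show q / p / (1 - 1 / p) = q / (p - 1) by field_simp] at h1
  have hexp : ENNReal.ofReal p' ≤ ENNReal.ofReal (q / (p - 1)) :=
    ENNReal.ofReal_le_ofReal (div_le_div_of_nonneg_right hpq.le (by linarith))
  have haθ' : ∀ i, MemLp (fun x => a i x (weakGrad Ω θ x)) (ENNReal.ofReal p') μ := fun i =>
    (haθ i).mono_exponent hexp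
  have hf' : ∀ i, MemLp (f i) (ENNReal.ofReal p') μ := fun i => (hf i).mono_exponent hexp
  set G : EuclideanSpace ℝ (Fin n) → ℝ :=
    fun x => ∑ i, |f i x - a i x (weakGrad Ω θ x)| ^ p' with hGdef
  -- The gain of the whole argument: `q/(p-1)` divided by `p'` is `q/p > 1`, so `G` is better than
  -- integrable.
  have hG : MemLp G (ENNReal.ofReal (q / p)) μ := by
    refine memLp_finsetSum _ fun i _ => ?_
    have h1 := ((hf i).sub (haθ i)).abs_rpow hp'0
    rwa [show q / (p - 1) / p' = q / p by rw [hp']; field_simp] at h1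
  obtain ⟨C, hC0, hC⟩ := exists_energy_const hpp hν
  have hmono' : ∀ᵐ x ∂μ, ν * ∑ i, |weakDeriv Ω i w x| ^ p ≤
      ∑ i, (a i x (weakGrad Ω u x) - a i x (weakGrad Ω θ x)) * weakDeriv Ω i w x := by
    filter_upwards [hmono, ae_all_iff.2 hDu] with x hx hxu
    have e : ∀ i, weakGrad Ω u x i - weakGrad Ω θ x i = weakDeriv Ω i w x := fun i => by
      change weakDeriv Ω i u x - weakDeriv Ω i θ x = _
      rw [hxu i, add_sub_cancel_right]
    simpa only [e] using hx (weakGrad Ω u x) (weakGrad Ω θ x)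
  have hr : NNReal.HolderConjugate (n : NNReal) (NNReal.conjExponent n) :=
    NNReal.HolderConjugate.conjExponent (by exact_mod_cast hn)
  have hαr : 1 / ((NNReal.conjExponent n : NNReal) : ℝ) = 1 - 1 / n := by
    have h1 := hr.coe.one_sub_inv
    rw [NNReal.coe_natCast] at h1
    rw [one_div, one_div, h1]
  -- With these exponents `α - β = 1/q - 1/n = (n - q)/(nq)`, the reciprocal of the target exponent;
  -- `q < n` makes it positive.
  refine memWeakLp_of_decay (α := 1 - 1 / n) (β := 1 - 1 / q) hw.1.1.1.aemeasurable ?_ ?_ ?_ ?_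
    (C := (eLpNormLESNormFDerivOneConst (volume : Measure (EuclideanSpace ℝ (Fin n)))
      (NNReal.conjExponent n) : ℝ≥0∞) * n *
      (ENNReal.ofReal C * eLpNorm G (ENNReal.ofReal (q / p)) μ) ^ (1 / p)) ?_ ?_
  · rw [sub_nonneg, div_le_one hq0]
    linarith
  · rw [sub_pos, div_lt_one hn0]
    linarith
  · exact div_pos (mul_pos hn0 hq0) (by linarith)
  · have : (n : ℝ) - q ≠ 0 := by linarith
    field_simp
    ring
  · exact ENNReal.mul_ne_top (ENNReal.mul_ne_top ENNReal.coe_ne_top (ENNReal.natCast_ne_top _))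
      (ENNReal.rpow_ne_top_of_nonneg (by positivity)
        (ENNReal.mul_ne_top ENNReal.ofReal_ne_top hG.2.ne))
  · intro k hk
    obtain ⟨η, χ, hη, hd, hc, h0, h1, hχk, hz, hηk⟩ := exists_smooth_truncation hk
    obtain ⟨hv, hDv⟩ := hw.comp_smooth hη hd hc h0 h1 hz
    have hX : AEStronglyMeasurable (fun x => χ (w x)) μ :=
      hc.comp_aestronglyMeasurable hw.1.1.1
    have hXD : ∀ i, MemLp (fun x => χ (w x) * weakDeriv Ω i w x) (ENNReal.ofReal p) μ := by
      intro i
      refine (hDw i).mono (hX.mul (hDw i).1) (Eventually.of_forall fun x => ?_)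
      rw [norm_mul, Real.norm_of_nonneg (h0 _)]
      exact mul_le_of_le_one_left (norm_nonneg _) (h1 _)
    have hsol := heq (fun x => η (w x)) ⟨hv, fun i => (hXD i).ae_eq (hDv i).symm⟩
    -- Stated for a general field `b` so that the same subtraction of the `a(x, Dθ)` integral
    -- applies to both sides of the weak equation, with `b = a(x, Du)` and `b = f`.
    have hsub : ∀ b : Fin n → EuclideanSpace ℝ (Fin n) → ℝ,
        (∀ i, MemLp (b i) (ENNReal.ofReal p') μ) →
        ∫ x, ∑ i, (b i x - a i x (weakGrad Ω θ x)) * (χ (w x) * weakDeriv Ω i w x) ∂μ =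
          (∫ x, ∑ i, b i x * weakDeriv Ω i (fun x => η (w x)) x ∂μ) -
          ∫ x, ∑ i, a i x (weakGrad Ω θ x) * (χ (w x) * weakDeriv Ω i w x) ∂μ := by
      intro b hb
      have : (ENNReal.ofReal p').HolderTriple (ENNReal.ofReal p) 1 := hpp.symm.ennrealOfReal
      have hint : ∀ b : Fin n → EuclideanSpace ℝ (Fin n) → ℝ,
          (∀ i, MemLp (b i) (ENNReal.ofReal p') μ) →
          Integrable (fun x => ∑ i, b i x * (χ (w x) * weakDeriv Ω i w x)) μ :=
        fun b hb => integrable_finsetSum _ fun i _ => (hb i).integrable_mul (hXD i)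
      have e : ∫ x, ∑ i, b i x * weakDeriv Ω i (fun x => η (w x)) x ∂μ =
          ∫ x, ∑ i, b i x * (χ (w x) * weakDeriv Ω i w x) ∂μ := by
        refine integral_congr_ae ?_
        filter_upwards [ae_all_iff.2 hDv] with x hx
        exact Finset.sum_congr rfl fun i _ => by rw [hx i]
      rw [e, ← integral_sub (hint b hb) (hint _ haθ')]
      simp only [sub_mul, Finset.sum_sub_distrib]
    have hE := hC (D := fun i => weakDeriv Ω i w)
      (A := fun i x => a i x (weakGrad Ω u x) - a i x (weakGrad Ω θ x))
      (F := fun i x => f i x - a i x (weakGrad Ω θ x)) (X := fun x => χ (w x))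
      hDw (fun i => (hau i).sub (haθ' i)) (fun i => (hf' i).sub (haθ' i)) hX
      (fun _ => h0 _) (fun _ => h1 _) hmono' (by
        rw [hsub (fun i x => a i x (weakGrad Ω u x)) hau, hsub f hf']
        exact congrArg (· - _) hsol)
    have hmain := hw.mul_measure_superlevel_rpow_le hp hs hDw hr hη hd hc h0 h1 hz hχk hηk
      hG hC0 hE
    rwa [hαr, show (1 - 1 / (q / p)) * (1 / p) + (1 - 1 / p) = 1 - 1 / q by
      field_simp; ring] at hmain
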